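/- Let $\mathcal L(\Box,\rhd)$-formulas be given by $A ::= \bot \mid p \mid A\to A \mid \Box A \mid A\rhd A$ and $\mathcal L(\Box,\mathsf I)$-formulas by $A ::= \bot \mid p \mid A\to A \mid \Box A \mid \mathsf I A$, where $p$ ranges over countably many propositional variables; $\top,\neg,\wedge,\vee,\leftrightarrow$ are defined as usual and $\Diamond A := \neg\Box\neg A$. Every $\mathcal L(\Box,\mathsf I)$-formula is read as an $\mathcal L(\Box,\rhd)$-formula by taking $\mathsf I A$ as an abbreviation of $\top\rhd A$. Consider the following axiom schemata in $\mathcal L(\Box,\rhd)$. G1: all tautologies; G2: $\Box(A\to B)\to(\Box A\to\Box B)$; G3: $\Box(\Box A\to A)\to\Box A$; J1: $\Box(A\to B)\to A\rhd B$; J2: $(A\rhd B)\wedge(B\rhd C)\to A\rhd C$; J2$_+$: $(A\rhd(B\vee C))\wedge(B\rhd C)\to A\rhd C$; J3: $(A\rhd C)\wedge(B\rhd C)\to(A\vee B)\rhd C$; J4: $A\rhd B\to(\Diamond A\to\Diamond B)$; J4$_+$: $\Box(A\to B)\to(C\rhd A\to C\rhd B)$; J5: $\Diamond A\rhd A$;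 J6: $\Box A\leftrightarrow(\neg A\rhd\bot)$. The logic $\mathbf{IL}$ has the axioms G1–G3, J1–J5 and the rules Modus Ponens and Necessitation; $\mathbf{CL}$ is $\mathbf{IL}$ without J5. The logic $\mathbf{IL}^-$ has the axioms G1, G2, G3, J3, J6 and the rules Modus Ponens, Necessitation, R1: from $A\to B$ infer $(C\rhd A)\to(C\rhd B)$, and R2: from $A\to B$ infer $(B\rhd C)\to(A\rhd C)$. In $\mathcal L(\Box,\mathsf I)$ consider J1$'$: $\Box A\to\mathsf I A$; J15$'$: $\Box(A\vee\Diamond A)\to\mathsf I A$; J25$'$: $\Box(A\to\Diamond B)\to(\mathsf I A\to\mathsf I B)$; I2: $\Box(A\to B)\to(\mathsf I A\to\mathsf I B)$; I3: $\mathsf I(A\vee\Diamond A)\to\mathsf I A$; I4: $\mathsf I A\wedge\Diamond\top\to\Diamond A$. The logic $\mathbf{il}^-$ has as axioms all tautologies of $\mathcal L(\Box,\mathsf I)$, G2, G3 and $\Box\bot\leftrightarrow\mathsf I\bot$, and the rules Modus Ponens, Necessitation, and: from $A\to B$ infer $\mathsf I A\to\mathsf I B$. For a logic $L$ write $L(\Sigma_1,\dots,\Sigma_k)$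 for the logic with the additional axiom schemata $\Sigma_1,\dots,\Sigma_k$ and the same rules. **Theorem.** Let $(L,\ell)$ be one of the following twenty pairs: - $(\mathbf{IL}^-,\ \mathbf{il}^-)$, $(\mathbf{IL}^-(\mathrm{J5}),\ \mathbf{il}^-)$; - $(\mathbf{IL}^-(\mathrm{J1}),\ \mathbf{il}^-(\mathrm{J1}'))$; - $(\mathbf{IL}^-(\mathrm{J4}_+),\ \mathbf{il}^-(\mathrm{I2}))$, $(\mathbf{IL}^-(\mathrm{J4}_+,\mathrm{J5}),\ \mathbf{il}^-(\mathrm{I2}))$, $(\mathbf{IL}^-(\mathrm{J2}_+),\ \mathbf{il}^-(\mathrm{I2}))$, $(\mathbf{IL}^-(\mathrm{J2},\mathrm{J4}_+),\ \mathbf{il}^-(\mathrm{I2}))$; - $(\mathbf{IL}^-(\mathrm{J1},\mathrm{J5}),\ \mathbf{il}^-(\mathrm{J15}'))$; - $(\mathbf{IL}^-(\mathrm{J1},\mathrm{J4}_+),\ \mathbf{il}^-(\mathrm{J1}',\mathrm{I2}))$, $(\mathbf{CL},\ \mathbf{il}^-(\mathrm{J1}',\mathrm{I2}))$; - $(\mathbf{IL}^-(\mathrm{J1},\mathrm{J4}_+,\mathrm{J5}),\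 \mathbf{il}^-(\mathrm{J15}',\mathrm{I2}))$; - $(\mathbf{IL}^-(\mathrm{J2}_+,\mathrm{J5}),\ \mathbf{il}^-(\mathrm{I2},\mathrm{I3}))$; - $(\mathbf{IL},\ \mathbf{il}^-(\mathrm{J1}',\mathrm{I2},\mathrm{I3}))$; - $(\mathbf{IL}^-(\mathrm{J4}),\ \mathbf{il}^-(\mathrm{I4}))$, $(\mathbf{IL}^-(\mathrm{J4},\mathrm{J5}),\ \mathbf{il}^-(\mathrm{I4}))$, $(\mathbf{IL}^-(\mathrm{J2}),\ \mathbf{il}^-(\mathrm{I4}))$; - $(\mathbf{IL}^-(\mathrm{J1},\mathrm{J4}),\ \mathbf{il}^-(\mathrm{J1}',\mathrm{I4}))$; - $(\mathbf{IL}^-(\mathrm{J1},\mathrm{J4},\mathrm{J5}),\ \mathbf{il}^-(\mathrm{J15}',\mathrm{I4}))$; - $(\mathbf{IL}^-(\mathrm{J2},\mathrm{J5}),\ \mathbf{il}^-(\mathrm{J25}',\mathrm{I4}))$; - $(\mathbf{IL}^-(\mathrm{J2},\mathrm{J4}_+,\mathrm{J5}),\ \mathbf{il}^-(\mathrm{I2},\mathrm{J25}'))$.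 Then for every $\mathcal L(\Box,\mathsf I)$-formula $A$, $L\vdash A$ if and only if $\ell\vdash A$. The same holds when $\mathbf{CL}$ and $\mathbf{IL}$ are presented as $\mathbf{IL}^-(\mathrm{J1},\mathrm{J2}_+)$ and $\mathbf{IL}^-(\mathrm{J1},\mathrm{J2}_+,\mathrm{J5})$. -/

import Mathlib

namespace UnaryIL

/-! ## The binary language `L(□, ▷)` -/

/-- Formulas `A ::= ⊥ | p | A → A | □A | A ▷ A`, over the variables `p₀, p₁, …`. -/
inductive Fml : Type
  | bot : Fml
  | var : ℕ → Fml
  | imp : Fml → Fml → Fml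
  | box : Fml → Fml
  | rhd : Fml → Fml → Fml

namespace Fml

def neg (A : Fml) : Fml := imp A bot
def top : Fml := neg bot
def or (A B : Fml) : Fml := imp (neg A) B
def and (A B : Fml) : Fml := neg (imp A (neg B))
def iff (A B : Fml) : Fml := and (imp A B) (imp B A)
def dia (A : Fml) : Fml := neg (box (neg A))

/-- `A` is a tautology in the language `L(□, ▷)`: it is true under every Boolean valuation of
formulas, where variables, boxed formulas and formulas `A ▷ B` are treated as atoms. -/
def IsTautology (A : Fml) : Prop :=
  ∀ v : Fml → Prop, ¬ v bot → (∀ B C, v (imp B C) ↔ (v B → v C)) → v A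

/-- J1: `□(A → B) → A ▷ B`. -/
def J1 : Set Fml := {F | ∃ A B, F = imp (box (imp A B)) (rhd A B)}

/-- J2: `(A ▷ B) ∧ (B ▷ C) → A ▷ C`. -/
def J2 : Set Fml := {F | ∃ A B C, F = imp (and (rhd A B) (rhd B C)) (rhd A C)}

/-- J2₊: `(A ▷ (B ∨ C)) ∧ (B ▷ C) → A ▷ C`. -/
def J2p : Set Fml := {F | ∃ A B C, F = imp (and (rhd A (or B C)) (rhd B C)) (rhd A C)}

/-- J3: `(A ▷ C) ∧ (B ▷ C) → (A ∨ B) ▷ C`. -/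
def J3 : Set Fml := {F | ∃ A B C, F = imp (and (rhd A C) (rhd B C)) (rhd (or A B) C)}

/-- J4: `A ▷ B → (◇A → ◇B)`. -/
def J4 : Set Fml := {F | ∃ A B, F = imp (rhd A B) (imp (dia A) (dia B))}

/-- J4₊: `□(A → B) → (C ▷ A → C ▷ B)`. -/
def J4p : Set Fml := {F | ∃ A B C, F = imp (box (imp A B)) (imp (rhd C A) (rhd C B))}

/-- J5: `◇A ▷ A`. -/
def J5 : Set Fml := {F | ∃ A, F = rhd (dia A) A}

/-- J6: `□A ↔ (¬A ▷ ⊥)`. -/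
def J6 : Set Fml := {F | ∃ A, F = iff (box A) (rhd (neg A) bot)}

end Fml

open Fml in
/-- `GLProves X A`: `A` is derivable from G1, G2, G3 and the axioms in `X` by Modus Ponens and
Necessitation. -/
inductive GLProves (X : Set Fml) : Fml → Prop
  | ax {A : Fml} : A ∈ X → GLProves X A
  | G1 {A : Fml} : IsTautology A → GLProves X A
  | G2 (A B : Fml) : GLProves X (imp (box (imp A B)) (imp (box A) (box B)))
  | G3 (A : Fml) : GLProves X (imp (box (imp (box A) A)) (box A))
  | mp {A B : Fml} : GLProves X A → GLProves X (imp A B) → GLProves X B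
  | nec {A : Fml} : GLProves X A → GLProves X (box A)

/-- Provability in the interpretability logic `IL`. -/
def IL : Fml → Prop := GLProves (Fml.J1 ∪ Fml.J2 ∪ Fml.J3 ∪ Fml.J4 ∪ Fml.J5)

/-- Provability in the conservativity logic `CL`, i.e. `IL` without J5. -/
def CL : Fml → Prop := GLProves (Fml.J1 ∪ Fml.J2 ∪ Fml.J3 ∪ Fml.J4)

open Fml in
/-- `ILm X A`: `A` is provable in `IL⁻(X)`, the logic `IL⁻` with the additional axioms in `X`. -/
inductive ILm (X : Set Fml) : Fml → Prop
  | ax {A : Fml} : A ∈ X → ILm X A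
  | G1 {A : Fml} : IsTautology A → ILm X A
  | G2 (A B : Fml) : ILm X (imp (box (imp A B)) (imp (box A) (box B)))
  | G3 (A : Fml) : ILm X (imp (box (imp (box A) A)) (box A))
  | J3 {A : Fml} : A ∈ Fml.J3 → ILm X A
  | J6 {A : Fml} : A ∈ Fml.J6 → ILm X A
  | mp {A B : Fml} : ILm X A → ILm X (imp A B) → ILm X B
  | nec {A : Fml} : ILm X A → ILm X (box A)
  | R1 {A B : Fml} (C : Fml) : ILm X (imp A B) → ILm X (imp (rhd C A) (rhd C B))
  | R2 {A B : Fml} (C : Fml) : ILm X (imp A B) → ILm X (imp (rhd B C) (rhd A C))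

/-! ## The unary language `L(□, I)` -/

/-- Formulas `A ::= ⊥ | p | A → A | □A | I A`, over the variables `p₀, p₁, …`. -/
inductive UFml : Type
  | bot : UFml
  | var : ℕ → UFml
  | imp : UFml → UFml → UFml
  | box : UFml → UFml
  | I : UFml → UFml

namespace UFml

/-- Reading an `L(□, I)`-formula as an `L(□, ▷)`-formula, `I A` abbreviating `⊤ ▷ A`. -/
def toFml : UFml → Fml
  | bot => Fml.bot
  | var n => Fml.var n
  | imp A B => Fml.imp A.toFml B.toFml
  | box A => Fml.box A.toFml
  | I A => Fml.rhd Fml.top A.toFml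

def neg (A : UFml) : UFml := imp A bot
def top : UFml := neg bot
def or (A B : UFml) : UFml := imp (neg A) B
def and (A B : UFml) : UFml := neg (imp A (neg B))
def iff (A B : UFml) : UFml := and (imp A B) (imp B A)
def dia (A : UFml) : UFml := neg (box (neg A))

/-- `A` is a tautology in the language `L(□, I)`. -/
def IsTautology (A : UFml) : Prop :=
  ∀ v : UFml → Prop, ¬ v bot → (∀ B C, v (imp B C) ↔ (v B → v C)) → v A

/-- J1′: `□A → I A`. -/
def uJ1 : Set UFml := {F | ∃ A, F = imp (box A) (I A)}

/-- J15′: `□(A ∨ ◇A) → I A`. -/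
def uJ15 : Set UFml := {F | ∃ A, F = imp (box (or A (dia A))) (I A)}

/-- J25′: `□(A → ◇B) → (I A → I B)`. -/
def uJ25 : Set UFml := {F | ∃ A B, F = imp (box (imp A (dia B))) (imp (I A) (I B))}

/-- I2: `□(A → B) → (I A → I B)`. -/
def I2 : Set UFml := {F | ∃ A B, F = imp (box (imp A B)) (imp (I A) (I B))}

/-- I3: `I (A ∨ ◇A) → I A`. -/
def I3 : Set UFml := {F | ∃ A, F = imp (I (or A (dia A))) (I A)}

/-- I4: `I A ∧ ◇⊤ → ◇A`. -/
def I4 : Set UFml := {F | ∃ A, F = imp (and (I A) (dia top)) (dia A)}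

end UFml

open UFml in
/-- `ilm X A`: `A` is provable in `il⁻(X)`, the logic `il⁻` with the additional axioms in `X`.
The constructor `uJ6` is the axiom `□⊥ ↔ I ⊥`, and `uR` the rule `A → B / I A → I B`. -/
inductive ilm (X : Set UFml) : UFml → Prop
  | ax {A : UFml} : A ∈ X → ilm X A
  | G1 {A : UFml} : IsTautology A → ilm X A
  | G2 (A B : UFml) : ilm X (imp (box (imp A B)) (imp (box A) (box B)))
  | G3 (A : UFml) : ilm X (imp (box (imp (box A) A)) (box A))
  | uJ6 : ilm X (iff (box bot) (I bot))
  | mp {A B : UFml} : ilm X A → ilm X (imp A B) → ilm X B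
  | nec {A : UFml} : ilm X A → ilm X (box A)
  | uR {A B : UFml} : ilm X (imp A B) → ilm X (imp (I A) (I B))

open Fml UFml in
/-- The rows `(L, ℓ)`: a sublogic `L` of `IL` and the unary logic `ℓ` that corresponds to it.
There are twenty sublogics; `CL` and `IL` are each listed in two presentations, the original one
and the one as an extension of `IL⁻`. -/
def table : List ((Fml → Prop) × (UFml → Prop)) :=
  [ (ILm ∅, ilm ∅),
    (ILm J5, ilm ∅),
    (ILm J1, ilm uJ1),
    (ILm J4p, ilm I2),
    (ILm (J4p ∪ J5), ilm I2),
    (ILm J2p, ilm I2),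
    (ILm (J1 ∪ J5), ilm uJ15),
    (ILm (J1 ∪ J4p), ilm (uJ1 ∪ I2)),
    (CL, ilm (uJ1 ∪ I2)),
    (ILm (J1 ∪ J2p), ilm (uJ1 ∪ I2)),
    (ILm (J1 ∪ J4p ∪ J5), ilm (uJ15 ∪ I2)),
    (ILm (J2p ∪ J5), ilm (I2 ∪ I3)),
    (IL, ilm (uJ1 ∪ I2 ∪ I3)),
    (ILm (J1 ∪ J2p ∪ J5), ilm (uJ1 ∪ I2 ∪ I3)),
    (ILm J4, ilm I4),
    (ILm (J4 ∪ J5), ilm I4),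
    (ILm J2, ilm I4),
    (ILm (J1 ∪ J4), ilm (uJ1 ∪ I4)),
    (ILm (J1 ∪ J4 ∪ J5), ilm (uJ15 ∪ I4)),
    (ILm (J2 ∪ J5), ilm (uJ25 ∪ I4)),
    (ILm (J2 ∪ J4p), ilm I2),
    (ILm (J2 ∪ J4p ∪ J5), ilm (I2 ∪ uJ25)) ]

end UnaryIL

namespace UnaryIL

/-!
Passing from `⊤ ▷ A` to `I A` is sound because each unary axiom is derivable when `I A` is read as
`⊤ ▷ A`. For the converse, translate `A ▷ B` back as `□(A → δB) ∨ I B`, where `δB` is the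
disjunction of `B` (if J1 is an axiom) and `◇B` (if J5 is an axiom). This maps theorems of `L` to
theorems of `ℓ`, and as `ℓ` proves `□δA → I A`, the image `□(⊤ → δA) ∨ I A` of `I A` is equivalent
to `I A`, so that unary formulas are fixed up to provable equivalence.

All derivations take place in the canonical model: a formula is provable if it is true in all
worlds, and `□A` is true in a world if and only if `A` is true in all accessible worlds.
-/

/-! ## Worlds -/

section Worlds

/-- `v` is a Boolean valuation of formulas, where `bot` and `imp` are falsum and implication and
all other formulas are treated as atoms. The three are variables so that both languages are
covered. -/
structure IsValuation {F : Type*} (bot : F) (imp : F → F → F) (v : F → Prop) : Prop where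
  bot : ¬ v bot
  imp {B C : F} : v (imp B C) ↔ (v B → v C)

/-- `v` is a world of the logic with set of theorems `P`, that is, the characteristic predicate of
a maximal consistent set containing `P`. -/
structure IsWorld {F : Type*} (bot : F) (imp : F → F → F) (P v : F → Prop) : Prop
    extends IsValuation bot imp v where
  thm {B : F} : P B → v B

/-- The accessibility relation of the canonical model of a modal logic with modality `box`. -/
def Accessible {F : Type*} (box : F → F) (v u : F → Prop) : Prop :=
  ∀ B, v (box B) → u B

/-- `P` is the set of theorems of an extension of provability logic `GL`. -/
class IsGLExtension {F : Type*} (bot : outParam F) (imp : outParam (F → F → F))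
    (box : outParam (F → F)) (P : F → Prop) : Prop where
  taut {A : F} : (∀ v, IsValuation bot imp v → v A) → P A
  mp {A B : F} : P A → P (imp A B) → P B
  distrib (A B : F) : P (imp (box (imp A B)) (imp (box A) (box B)))
  loeb (A : F) : P (imp (box (imp (box A) A)) (box A))
  nec {A : F} : P A → P (box A)

variable {F : Type*} {bot : F} {imp : F → F → F} {box : F → F} {P v u t : F → Prop} {A B C : F}

namespace IsValuation

theorem neg (h : IsValuation bot imp v) : v (imp A bot) ↔ ¬ v A :=
  h.imp.trans (imp_congr_right fun _ => iff_false_intro h.bot)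

theorem or (h : IsValuation bot imp v) : v (imp (imp A bot) B) ↔ v A ∨ v B := by
  rw [h.imp, h.neg]; tauto

theorem and (h : IsValuation bot imp v) : v (imp (imp A (imp B bot)) bot) ↔ v A ∧ v B := by
  rw [h.neg, h.imp, h.neg]; tauto

theorem iff (h : IsValuation bot imp v) :
    v (imp (imp (imp A B) (imp (imp B A) bot)) bot) ↔ (v A ↔ v B) := by
  rw [h.and, h.imp, h.imp]; exact iff_def.symm

theorem foldr_imp (h : IsValuation bot imp v) (l : List F) :
    v (l.foldr imp A) ↔ ((∀ B ∈ l, v B) → v A) := by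
  induction l with
  | nil => simp
  | cons B l ih => rw [List.foldr_cons, h.imp, ih, List.forall_mem_cons, and_imp]

end IsValuation

theorem isClosed_setOf_isValuation :
    IsClosed {v : F → Bool | IsValuation bot imp fun B => v B = true} := by
  have h : {v : F → Bool | IsValuation bot imp fun B => v B = true} =
      {v | v bot = false} ∩ ⋂ B, ⋂ C, {v | v (imp B C) = (!v B || v C)} := by
    ext v
    simp only [Set.mem_ofPred_eq, Set.mem_inter_iff, Set.mem_iInter]
    refine ⟨fun hv => ⟨by simpa using hv.bot, fun B C => ?_⟩, fun hv => ⟨by simp [hv.1], ?_⟩⟩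
    · have := hv.imp (B := B) (C := C); grind
    · intro B C; have := hv.2 B C; grind
  rw [h]
  refine (isClosed_eq (by fun_prop) (by fun_prop)).inter
    (isClosed_iInter fun B => isClosed_iInter fun C => isClosed_eq (by fun_prop) ?_)
  exact (continuous_of_discreteTopology (f := fun x : Bool × Bool => (!x.1 || x.2))).comp
    (by fun_prop : Continuous fun v : F → Bool => (v B, v C))

/-- Compactness of propositional logic, from compactness of `F → Bool`. -/
theorem exists_list_of_forall_isValuation {Γ : Set F}
    (h : ∀ v, IsValuation bot imp v → (∀ B ∈ Γ, v B) → v A) :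
    ∃ l : List F, (∀ B ∈ l, B ∈ Γ) ∧ ∀ v, IsValuation bot imp v → (∀ B ∈ l, v B) → v A := by
  classical
  let K : Set (F → Bool) := {v | IsValuation bot imp fun B => v B = true} ∩ {v | v A = false}
  have hK : IsCompact K :=
    (isClosed_setOf_isValuation.inter (isClosed_eq (by fun_prop) (by fun_prop))).isCompact
  have hKΓ : K ∩ ⋂ B : Γ, {v | v B = true} = ∅ := by
    refine Set.eq_empty_of_forall_notMem fun v ⟨⟨hv, hA⟩, hΓ⟩ => ?_
    exact Bool.false_ne_true (hA.symm.trans (h _ hv fun B hB => Set.mem_iInter.1 hΓ ⟨B, hB⟩))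
  obtain ⟨s, hs⟩ := hK.elim_finite_subfamily_closed (fun B : Γ => {v | v B = true})
    (fun B => isClosed_eq (by fun_prop) (by fun_prop)) hKΓ
  refine ⟨s.toList.map (↑), by simp +contextual, fun v hv hvs => by_contra fun hA => ?_⟩
  refine Set.eq_empty_iff_forall_notMem.1 hs (fun B => decide (v B)) ⟨⟨?_, ?_⟩, ?_⟩
  · simpa using hv
  · simpa using hA
  · simpa using hvs

theorem provable_of_forall_isWorld (taut : ∀ {A}, (∀ v, IsValuation bot imp v → v A) → P A)
    (mp : ∀ {A B}, P A → P (imp A B) → P B) (h : ∀ v, IsWorld bot imp P v → v A) : P A := by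
  obtain ⟨l, hl, hlA⟩ := exists_list_of_forall_isValuation (Γ := {B | P B})
    fun v hv hP => h v ⟨hv, hP _⟩
  have hfold : P (l.foldr imp A) := taut fun v hv => (hv.foldr_imp l).2 (hlA v hv)
  clear hlA
  induction l with
  | nil => exact hfold
  | cons B l ih =>
    rw [List.forall_mem_cons] at hl
    exact ih hl.2 (mp hl.1 hfold)

theorem IsGLExtension.of_forall_isWorld [IsGLExtension bot imp box P]
    (h : ∀ v, IsWorld bot imp P v → v A) : P A :=
  provable_of_forall_isWorld taut mp h

namespace IsWorld

variable [IsGLExtension bot imp box P]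

theorem box_iff (w : IsWorld bot imp P v) :
    v (box A) ↔ ∀ u, IsWorld bot imp P u → Accessible box v u → u A := by
  refine ⟨fun hA u _ hu => hu A hA, fun h => ?_⟩
  -- The worlds of the theory `{B | v (□B)}` are the worlds accessible from `v`.
  refine provable_of_forall_isWorld (bot := bot) (imp := imp) (P := fun B => v (box B))
    (fun hB => w.thm (IsGLExtension.nec (IsGLExtension.taut hB)))
    (fun hB hBC => w.imp.1 (w.imp.1 (w.thm (IsGLExtension.distrib _ _)) hBC) hB) fun u hu => ?_
  exact h u ⟨hu.toIsValuation, fun hB => hu.thm (w.thm (IsGLExtension.nec hB))⟩ fun _ => hu.thm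

theorem loeb (w : IsWorld bot imp P v)
    (h : ∀ u, IsWorld bot imp P u → Accessible box v u → u (box A) → u A) : v (box A) :=
  w.imp.1 (w.thm (IsGLExtension.loeb A)) (w.box_iff.2 fun u wu hu => wu.imp.2 (h u wu hu))

theorem box_box (w : IsWorld bot imp P v) (hA : v (box A)) : v (box (box A)) := by
  -- Löb's axiom for `A ∧ □A`.
  have h : v (box (imp (imp A (imp (box A) bot)) bot)) :=
    w.loeb fun u wu hu h => wu.and.2 ⟨hu A hA, wu.box_iff.2 fun t wt ht => (wt.and.1 (ht _ h)).1⟩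
  exact w.box_iff.2 fun u wu hu => (wu.and.1 (hu _ h)).2

theorem accessible_trans (w : IsWorld bot imp P v) (hvu : Accessible box v u)
    (hut : Accessible box u t) : Accessible box v t :=
  fun _ hB => hut _ (hvu _ (w.box_box hB))

theorem dia_iff (w : IsWorld bot imp P v) :
    v (imp (box (imp A bot)) bot) ↔ ∃ u, IsWorld bot imp P u ∧ Accessible box v u ∧ u A := by
  rw [w.neg, w.box_iff]
  push Not
  exact exists_congr fun u => and_congr_right fun wu => and_congr_right fun _ => by
    rw [wu.neg, not_not]

end IsWorld

end Worlds

instance (X : Set Fml) : IsGLExtension Fml.bot Fml.imp Fml.box (GLProves X) where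
  taut h := .G1 fun v hb hi => h v ⟨hb, hi _ _⟩
  mp := .mp
  distrib := .G2
  loeb := .G3
  nec := .nec

instance (X : Set Fml) : IsGLExtension Fml.bot Fml.imp Fml.box (ILm X) where
  taut h := .G1 fun v hb hi => h v ⟨hb, hi _ _⟩
  mp := .mp
  distrib := .G2
  loeb := .G3
  nec := .nec

instance (Y : Set UFml) : IsGLExtension UFml.bot UFml.imp UFml.box (ilm Y) where
  taut h := .G1 fun v hb hi => h v ⟨hb, hi _ _⟩
  mp := .mp
  distrib := .G2
  loeb := .G3
  nec := .nec

/-- Worlds of the binary logic with set of theorems `P`. -/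
abbrev BWorld (P v : Fml → Prop) : Prop := IsWorld Fml.bot Fml.imp P v

/-- Worlds of the unary logic `ilm Y`. -/
abbrev UWorld (Y : Set UFml) (v : UFml → Prop) : Prop := IsWorld UFml.bot UFml.imp (ilm Y) v

/-- Accessibility between worlds of a binary logic. -/
abbrev BSees : (Fml → Prop) → (Fml → Prop) → Prop := Accessible Fml.box

/-- Accessibility between worlds of a unary logic. -/
abbrev USees : (UFml → Prop) → (UFml → Prop) → Prop := Accessible UFml.box

theorem ILm.of_forall_world {X : Set Fml} {A : Fml} (h : ∀ v, BWorld (ILm X) v → v A) :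
    ILm X A :=
  IsGLExtension.of_forall_isWorld h

theorem GLProves.of_forall_world {X : Set Fml} {A : Fml}
    (h : ∀ v, BWorld (GLProves X) v → v A) : GLProves X A :=
  IsGLExtension.of_forall_isWorld h

theorem ilm.of_forall_world {Y : Set UFml} {A : UFml} (h : ∀ v, UWorld Y v → v A) : ilm Y A :=
  IsGLExtension.of_forall_isWorld h

theorem ILm.subset {X S : Set Fml} (h : S ⊆ X) : S ⊆ {A | ILm X A} :=
  fun _ hA => .ax (h hA)

theorem ilm.subset {Y S : Set UFml} (h : S ⊆ Y) : S ⊆ {A | ilm Y A} :=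
  fun _ hA => .ax (h hA)

/-! ## Worlds of the unary logics -/

section Unary

variable {Y : Set UFml} {v u : UFml → Prop} {A B : UFml}

namespace IsWorld

theorem I_mono (w : UWorld Y v) (h : ∀ u, UWorld Y u → u A → u B) (hA : v (.I A)) : v (.I B) :=
  w.imp.1 (w.thm (.uR (.of_forall_world fun u wu => wu.imp.2 (h u wu)))) hA

theorem I_bot_iff (w : UWorld Y v) : v (.I .bot) ↔ v (.box .bot) :=
  (w.iff.1 (w.thm .uJ6)).symm

theorem I_of_box_bot (w : UWorld Y v) (h : v (.box .bot)) : v (.I A) :=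
  w.I_mono (fun _ wu hu => absurd hu wu.bot) (w.I_bot_iff.2 h)

theorem I_mono_of_I2 (w : UWorld Y v) (h2 : UFml.I2 ⊆ {F | ilm Y F})
    (h : ∀ u, UWorld Y u → USees v u → u A → u B) (hA : v (.I A)) : v (.I B) :=
  w.imp.1 (w.imp.1 (w.thm (h2 ⟨A, B, rfl⟩))
    (w.box_iff.2 fun u wu hu => wu.imp.2 (h u wu hu))) hA

theorem exists_of_I_of_I4 (w : UWorld Y v) (h4 : UFml.I4 ⊆ {F | ilm Y F}) (hA : v (.I A))
    (wu : UWorld Y u) (hu : USees v u) : ∃ t, UWorld Y t ∧ USees v t ∧ t A :=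
  w.dia_iff.1 (w.imp.1 (w.thm (h4 ⟨A, rfl⟩))
    (w.and.2 ⟨hA, w.dia_iff.2 ⟨u, wu, hu, wu.neg.2 wu.bot⟩⟩))

end IsWorld

theorem I4_subset_of_I2 (h2 : UFml.I2 ⊆ {F | ilm Y F}) : UFml.I4 ⊆ {F | ilm Y F} := by
  rintro _ ⟨A, rfl⟩
  refine ilm.of_forall_world fun v w => w.imp.2 fun h => ?_
  obtain ⟨hA, hTop⟩ := w.and.1 h
  obtain ⟨u, wu, hu, -⟩ := w.dia_iff.1 hTop
  refine w.neg.2 fun hnA => wu.bot (hu _ (w.I_bot_iff.1 ?_))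
  exact w.I_mono_of_I2 h2 (fun t wt ht hA => absurd hA (wt.neg.1 (ht _ hnA))) hA

theorem uJ15_subset_of_uJ1_of_I3 (h1 : UFml.uJ1 ⊆ {F | ilm Y F})
    (h3 : UFml.I3 ⊆ {F | ilm Y F}) : UFml.uJ15 ⊆ {F | ilm Y F} := by
  rintro _ ⟨A, rfl⟩
  exact ilm.of_forall_world fun v w => w.imp.2 fun h =>
    w.imp.1 (w.thm (h3 ⟨A, rfl⟩)) (w.imp.1 (w.thm (h1 ⟨_, rfl⟩)) h)

end Unary

/-! ## The translation of the binary into the unary language -/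

/-- The formula `δA` saying that `A` holds at a world that has to be counted as reachable from the
present one: the present world itself if J1 is an axiom (`j₁`), and the accessible worlds if J5 is
an axiom (`j₅`). -/
def UFml.reach : Bool → Bool → UFml → UFml
  | false, false, _ => .bot
  | false, true, A => .dia A
  | true, false, A => A
  | true, true, A => .or A (.dia A)

/-- The translation that replaces `A ▷ B` by `□(A → δB) ∨ I B`, with `δ` as in `UFml.reach`. -/
def Fml.toUnary (j₁ j₅ : Bool) : Fml → UFml
  | .bot => .bot
  | .var n => .var n
  | .imp A B => .imp (A.toUnary j₁ j₅) (B.toUnary j₁ j₅)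
  | .box A => .box (A.toUnary j₁ j₅)
  | .rhd A B => .or (.box (.imp (A.toUnary j₁ j₅) (.reach j₁ j₅ (B.toUnary j₁ j₅))))
      (.I (B.toUnary j₁ j₅))

section Translation

variable {j₁ j₅ : Bool} {X : Set Fml} {Y : Set UFml} {v u : UFml → Prop}

namespace IsWorld

section Reach

variable {A B : UFml}

theorem reach_iff (w : UWorld Y v) :
    v (.reach j₁ j₅ A) ↔ j₁ ∧ v A ∨ j₅ ∧ ∃ u, UWorld Y u ∧ USees v u ∧ u A := by
  rw [← w.dia_iff]
  cases j₁ <;> cases j₅ <;>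
    simp only [UFml.reach, UFml.or, UFml.dia, UFml.neg, w.imp, w.bot] <;> tauto

theorem not_reach_bot (w : UWorld Y v) : ¬ v (.reach j₁ j₅ .bot) := by
  rw [w.reach_iff]
  rintro (⟨-, h⟩ | ⟨-, u, wu, -, h⟩)
  exacts [w.bot h, wu.bot h]

theorem exists_of_reach (w : UWorld Y v) (wu : UWorld Y u) (hu : USees v u)
    (hA : u (.reach j₁ j₅ A)) : ∃ t, UWorld Y t ∧ USees v t ∧ t A := by
  rcases wu.reach_iff.1 hA with ⟨-, hA⟩ | ⟨-, t, wt, ht, hA⟩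
  exacts [⟨u, wu, hu, hA⟩, ⟨t, wt, w.accessible_trans hu ht, hA⟩]

theorem reach_bind (w : UWorld Y v) (h : v A → v B ∨ v (.reach j₁ j₅ B))
    (hs : ∀ u, UWorld Y u → USees v u → u A → u B ∨ u (.reach j₁ j₅ B))
    (hA : v (.reach j₁ j₅ A)) : v (.reach j₁ j₅ B) := by
  rcases w.reach_iff.1 hA with ⟨h₁, hA⟩ | ⟨h₅, u, wu, hu, hA⟩
  · exact (h hA).elim (fun hB => w.reach_iff.2 (.inl ⟨h₁, hB⟩)) id
  · refine w.reach_iff.2 (.inr ⟨h₅, ?_⟩)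
    exact (hs u wu hu hA).elim (fun hB => ⟨u, wu, hu, hB⟩) (w.exists_of_reach wu hu)

theorem I_bind (w : UWorld Y v) (h2 : UFml.I2 ⊆ {F | ilm Y F})
    (h3 : j₅ → UFml.I3 ⊆ {F | ilm Y F})
    (h : ∀ u, UWorld Y u → USees v u → u A → u B ∨ u (.reach j₁ j₅ B)) (hA : v (.I A)) :
    v (.I B) := by
  cases j₅ with
  | false =>
    refine w.I_mono_of_I2 h2 (fun u wu hu hA => (h u wu hu hA).elim id fun hB => ?_) hA
    exact ((wu.reach_iff.1 hB).resolve_right (by simp)).2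
  | true =>
    refine w.imp.1 (w.thm (h3 rfl ⟨B, rfl⟩)) (w.I_mono_of_I2 h2 (fun u wu hu hA => ?_) hA)
    refine wu.or.2 ((h u wu hu hA).elim .inl fun hB => ?_)
    exact (wu.reach_iff.1 hB).imp And.right fun hB => wu.dia_iff.2 hB.2

end Reach

theorem toUnary_rhd (w : UWorld Y v) {A B : Fml} :
    v ((A.rhd B).toUnary j₁ j₅) ↔
      (∀ u, UWorld Y u → USees v u →
        u (A.toUnary j₁ j₅) → u (.reach j₁ j₅ (B.toUnary j₁ j₅))) ∨
      v (.I (B.toUnary j₁ j₅)) :=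
  w.or.trans (or_congr_left (w.box_iff.trans
    (forall_congr' fun _ => forall_congr' fun wu => forall_congr' fun _ => wu.imp)))

end IsWorld

theorem toUnary_J1 : Fml.J1 ⊆ {A | ilm Y (A.toUnary true j₅)} := by
  rintro _ ⟨A, B, rfl⟩
  refine ilm.of_forall_world fun v w => w.imp.2 fun hAB => w.toUnary_rhd.2 (.inl ?_)
  exact fun u wu hu hA => wu.reach_iff.2 (.inl ⟨rfl, wu.imp.1 (hu _ hAB) hA⟩)

theorem toUnary_J2_of_I4 (h4 : UFml.I4 ⊆ {F | ilm Y F}) :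
    Fml.J2 ⊆ {A | ilm Y (A.toUnary false false)} := by
  rintro _ ⟨A, B, C, rfl⟩
  refine ilm.of_forall_world fun v w => w.imp.2 fun h => w.toUnary_rhd.2 ?_
  obtain ⟨hAB, hBC⟩ := w.and.1 h
  rcases w.toUnary_rhd.1 hBC with hBC | hC
  · refine .inl fun u wu hu hA => ?_
    rcases w.toUnary_rhd.1 hAB with hAB | hB
    · exact absurd (hAB u wu hu hA) wu.bot
    · obtain ⟨t, wt, ht, htB⟩ := w.exists_of_I_of_I4 h4 hB wu hu
      exact absurd (hBC t wt ht htB) wt.bot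
  · exact .inr hC

theorem toUnary_J2_of_uJ25 (h25 : UFml.uJ25 ⊆ {F | ilm Y F}) :
    Fml.J2 ⊆ {A | ilm Y (A.toUnary false true)} := by
  rintro _ ⟨A, B, C, rfl⟩
  refine ilm.of_forall_world fun v w => w.imp.2 fun h => w.toUnary_rhd.2 ?_
  obtain ⟨hAB, hBC⟩ := w.and.1 h
  rcases w.toUnary_rhd.1 hBC with hBC | hC
  · refine (w.toUnary_rhd.1 hAB).imp (fun hAB u wu hu hA => ?_) fun hB => ?_
    · exact wu.reach_bind (fun hB => .inr (hBC u wu hu hB))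
        (fun t wt ht hB => .inr (hBC t wt (w.accessible_trans hu ht) hB)) (hAB u wu hu hA)
    · exact w.imp.1 (w.imp.1 (w.thm (h25 ⟨_, _, rfl⟩))
        (w.box_iff.2 fun u wu hu => wu.imp.2 (hBC u wu hu))) hB
  · exact .inr hC

theorem toUnary_J2p (h2 : UFml.I2 ⊆ {F | ilm Y F}) (h3 : j₅ → UFml.I3 ⊆ {F | ilm Y F}) :
    Fml.J2p ⊆ {A | ilm Y (A.toUnary j₁ j₅)} := by
  rintro _ ⟨A, B, C, rfl⟩
  refine ilm.of_forall_world fun v w => w.imp.2 fun h => w.toUnary_rhd.2 ?_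
  obtain ⟨hAB, hBC⟩ := w.and.1 h
  rcases w.toUnary_rhd.1 hBC with hBC | hC
  · have hBC' : ∀ u, UWorld Y u → USees v u → u ((B.or C).toUnary j₁ j₅) →
        u (C.toUnary j₁ j₅) ∨ u (.reach j₁ j₅ (C.toUnary j₁ j₅)) :=
      fun u wu hu h => ((wu.or.1 h).imp_left (hBC u wu hu)).symm
    refine (w.toUnary_rhd.1 hAB).imp (fun hAB u wu hu hA => ?_) (w.I_bind h2 h3 hBC')
    exact wu.reach_bind (hBC' u wu hu)
      (fun t wt ht => hBC' t wt (w.accessible_trans hu ht)) (hAB u wu hu hA)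
  · exact .inr hC

theorem toUnary_J3 : Fml.J3 ⊆ {A | ilm Y (A.toUnary j₁ j₅)} := by
  rintro _ ⟨A, B, C, rfl⟩
  refine ilm.of_forall_world fun v w => w.imp.2 fun h => w.toUnary_rhd.2 ?_
  obtain ⟨hAC, hBC⟩ := w.and.1 h
  rcases w.toUnary_rhd.1 hAC, w.toUnary_rhd.1 hBC with ⟨hAC | hC, hBC | hC⟩
  · exact .inl fun u wu hu h => (wu.or.1 h).elim (hAC u wu hu) (hBC u wu hu)
  all_goals exact .inr hC

theorem toUnary_J4 (h4 : UFml.I4 ⊆ {F | ilm Y F}) :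
    Fml.J4 ⊆ {A | ilm Y (A.toUnary j₁ j₅)} := by
  rintro _ ⟨A, B, rfl⟩
  refine ilm.of_forall_world fun v w => w.imp.2 fun hAB => w.imp.2 fun hA => ?_
  obtain ⟨u, wu, hu, hA⟩ := w.dia_iff.1 hA
  refine w.dia_iff.2 ?_
  rcases w.toUnary_rhd.1 hAB with hAB | hB
  · exact w.exists_of_reach wu hu (hAB u wu hu hA)
  · exact w.exists_of_I_of_I4 h4 hB wu hu

theorem toUnary_J4p (h2 : UFml.I2 ⊆ {F | ilm Y F}) :
    Fml.J4p ⊆ {A | ilm Y (A.toUnary j₁ j₅)} := by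
  rintro _ ⟨A, B, C, rfl⟩
  refine ilm.of_forall_world fun v w => w.imp.2 fun hAB => w.imp.2 fun hCA => w.toUnary_rhd.2 ?_
  have hAB' : ∀ u, UWorld Y u → USees v u → u (A.toUnary j₁ j₅) → u (B.toUnary j₁ j₅) :=
    fun u wu hu => wu.imp.1 (hu _ hAB)
  refine (w.toUnary_rhd.1 hCA).imp (fun hCA u wu hu hC => ?_) (w.I_mono_of_I2 h2 hAB')
  exact wu.reach_bind (fun hA => .inl (hAB' u wu hu hA))
    (fun t wt ht hA => .inl (hAB' t wt (w.accessible_trans hu ht) hA)) (hCA u wu hu hC)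

theorem toUnary_J5 : Fml.J5 ⊆ {A | ilm Y (A.toUnary j₁ true)} := by
  rintro _ ⟨A, rfl⟩
  exact ilm.of_forall_world fun v w => w.toUnary_rhd.2 <| .inl fun u wu _ hA =>
    wu.reach_iff.2 (.inr ⟨rfl, wu.dia_iff.1 hA⟩)

theorem toUnary_J6 : Fml.J6 ⊆ {A | ilm Y (A.toUnary j₁ j₅)} := by
  rintro _ ⟨A, rfl⟩
  refine ilm.of_forall_world fun v w => w.iff.2 (Iff.trans ?_ w.toUnary_rhd.symm)
  constructor
  · exact fun hA => .inl fun u wu hu hnA => absurd (hu _ hA) (wu.neg.1 hnA)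
  · rintro (h | h)
    · exact w.box_iff.2 fun u wu hu => by_contra fun hA =>
        wu.not_reach_bot (h u wu hu (wu.neg.2 hA))
    · exact w.box_iff.2 fun u wu hu => absurd (hu _ (w.I_bot_iff.1 h)) wu.bot

theorem ILm.toUnary (hX : X ⊆ {A | ilm Y (A.toUnary j₁ j₅)}) {A : Fml} (h : ILm X A) :
    ilm Y (A.toUnary j₁ j₅) := by
  induction h with
  | ax h => exact hX h
  | G1 h => exact .G1 fun v hb hi => h (fun B => v (B.toUnary j₁ j₅)) hb fun _ _ => hi _ _
  | G2 A B => exact .G2 _ _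
  | G3 A => exact .G3 _
  | J3 h => exact toUnary_J3 h
  | J6 h => exact toUnary_J6 h
  | mp _ _ ih₁ ih₂ => exact .mp ih₁ ih₂
  | nec _ ih => exact .nec ih
  | @R1 A B C _ ih =>
    have hAB : ∀ u, UWorld Y u → u (A.toUnary j₁ j₅) → u (B.toUnary j₁ j₅) :=
      fun u wu => wu.imp.1 (wu.thm ih)
    refine .of_forall_world fun v w => w.imp.2 fun hCA => w.toUnary_rhd.2 ?_
    refine (w.toUnary_rhd.1 hCA).imp (fun hCA u wu hu hC => ?_) (w.I_mono hAB)
    exact wu.reach_bind (fun hA => .inl (hAB u wu hA)) (fun t wt _ hA => .inl (hAB t wt hA))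
      (hCA u wu hu hC)
  | R2 C _ ih =>
    refine .of_forall_world fun v w => w.imp.2 fun hBC => w.toUnary_rhd.2 ?_
    exact (w.toUnary_rhd.1 hBC).imp_left fun hBC u wu hu hA =>
      hBC u wu hu (wu.imp.1 (wu.thm ih) hA)

theorem IsWorld.toUnary_toFml_iff (hI : ∀ A, ilm Y (.imp (.box (.reach j₁ j₅ A)) (.I A)))
    (w : UWorld Y v) (A : UFml) : v (A.toFml.toUnary j₁ j₅) ↔ v A := by
  induction A generalizing v with
  | bot => exact Iff.rfl
  | var n => exact Iff.rfl
  | imp A B ihA ihB => exact w.imp.trans ((imp_congr (ihA w) (ihB w)).trans w.imp.symm)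
  | box A ih =>
    exact w.box_iff.trans (Iff.trans (forall₃_congr fun u wu _ => ih wu) w.box_iff.symm)
  | I A ih =>
    have hIA : v (.I (A.toFml.toUnary j₁ j₅)) ↔ v (.I A) :=
      ⟨w.I_mono fun u wu => (ih wu).1, w.I_mono fun u wu => (ih wu).2⟩
    refine w.toUnary_rhd.trans (Iff.trans (or_iff_right_of_imp fun h => ?_) hIA)
    exact w.imp.1 (w.thm (hI _)) (w.box_iff.2 fun u wu hu => h u wu hu (wu.neg.2 wu.bot))

theorem ilm_of_ILm_toFml (hI : ∀ A, ilm Y (.imp (.box (.reach j₁ j₅ A)) (.I A)))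
    (hX : X ⊆ {A | ilm Y (A.toUnary j₁ j₅)}) {A : UFml} (h : ILm X A.toFml) : ilm Y A :=
  .of_forall_world fun _ w => (w.toUnary_toFml_iff hI A).1 (w.thm (h.toUnary hX))

theorem ilm_box_reach_false_imp_I (A : UFml) :
    ilm Y (.imp (.box (.reach false j₅ A)) (.I A)) := by
  refine .of_forall_world fun v w => w.imp.2 fun h => w.I_of_box_bot (w.loeb fun u wu hu hb => ?_)
  obtain ⟨t, wt, ht, -⟩ := ((wu.reach_iff.1 (hu _ h)).resolve_left (by simp)).2
  exact absurd (ht _ hb) wt.bot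

end Translation

/-! ## Worlds of the binary logics -/

section Binary

variable {X : Set Fml} {P v u : Fml → Prop} {A B C : Fml}

namespace IsWorld

theorem rhd_of_J1 [IsGLExtension Fml.bot Fml.imp Fml.box P] (w : BWorld P v)
    (h1 : Fml.J1 ⊆ {F | P F}) (h : ∀ u, BWorld P u → BSees v u → u A → u B) : v (.rhd A B) :=
  w.imp.1 (w.thm (h1 ⟨A, B, rfl⟩)) (w.box_iff.2 fun u wu hu => wu.imp.2 (h u wu hu))

theorem rhd_trans (w : BWorld P v) (h2 : Fml.J2 ⊆ {F | P F}) (hAB : v (.rhd A B))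
    (hBC : v (.rhd B C)) : v (.rhd A C) :=
  w.imp.1 (w.thm (h2 ⟨A, B, C, rfl⟩)) (w.and.2 ⟨hAB, hBC⟩)

theorem rhd_trans_of_J2p (w : BWorld P v) (h2 : Fml.J2p ⊆ {F | P F})
    (hABC : v (.rhd A (.or B C))) (hBC : v (.rhd B C)) : v (.rhd A C) :=
  w.imp.1 (w.thm (h2 ⟨A, B, C, rfl⟩)) (w.and.2 ⟨hABC, hBC⟩)

theorem or_rhd (w : BWorld P v) (h3 : Fml.J3 ⊆ {F | P F}) (hAC : v (.rhd A C))
    (hBC : v (.rhd B C)) : v (.rhd (.or A B) C) :=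
  w.imp.1 (w.thm (h3 ⟨A, B, C, rfl⟩)) (w.and.2 ⟨hAC, hBC⟩)

theorem exists_of_rhd_of_J4 [IsGLExtension Fml.bot Fml.imp Fml.box P] (w : BWorld P v)
    (h4 : Fml.J4 ⊆ {F | P F}) (hAB : v (.rhd A B)) (wu : BWorld P u) (hu : BSees v u)
    (hA : u A) : ∃ t, BWorld P t ∧ BSees v t ∧ t B :=
  w.dia_iff.1 (w.imp.1 (w.imp.1 (w.thm (h4 ⟨A, B, rfl⟩)) hAB) (w.dia_iff.2 ⟨u, wu, hu, hA⟩))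

theorem rhd_mono_right (w : BWorld (ILm X) v) (h : ∀ u, BWorld (ILm X) u → u A → u B)
    (hA : v (.rhd C A)) : v (.rhd C B) :=
  w.imp.1 (w.thm (.R1 C (.of_forall_world fun u wu => wu.imp.2 (h u wu)))) hA

theorem rhd_mono_left (w : BWorld (ILm X) v) (h : ∀ u, BWorld (ILm X) u → u A → u B)
    (hB : v (.rhd B C)) : v (.rhd A C) :=
  w.imp.1 (w.thm (.R2 C (.of_forall_world fun u wu => wu.imp.2 (h u wu)))) hB

theorem rhd_bot_iff (w : BWorld (ILm X) v) : v (.rhd A .bot) ↔ v (.box A.neg) := by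
  refine Iff.trans ?_ (w.iff.1 (w.thm (.J6 ⟨A.neg, rfl⟩))).symm
  exact ⟨w.rhd_mono_left fun u wu h => not_not.1 fun hA => wu.neg.1 h (wu.neg.2 hA),
    w.rhd_mono_left fun u wu hA => wu.neg.2 fun h => wu.neg.1 h hA⟩

theorem rhd_of_forall_not (w : BWorld (ILm X) v)
    (h : ∀ u, BWorld (ILm X) u → BSees v u → ¬ u A) : v (.rhd A B) :=
  w.rhd_mono_right (fun _ wu hu => absurd hu wu.bot)
    (w.rhd_bot_iff.2 (w.box_iff.2 fun u wu hu => wu.neg.2 (h u wu hu)))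

theorem rhd_mono_left_of_sees (w : BWorld (ILm X) v)
    (h : ∀ u, BWorld (ILm X) u → BSees v u → u A → u B) (hBC : v (.rhd B C)) :
    v (.rhd A C) := by
  -- By J3, since `A` implies `(A ∧ ¬B) ∨ B`, where `A ∧ ¬B` is false in all accessible worlds.
  have hAnB : v (.rhd (A.and B.neg) C) := w.rhd_of_forall_not fun u wu hu hAB =>
    wu.neg.1 (wu.and.1 hAB).2 (h u wu hu (wu.and.1 hAB).1)
  refine w.rhd_mono_left (fun u wu hA => ?_) (w.or_rhd (fun _ => .J3) hAnB hBC)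
  exact wu.or.2 (or_iff_not_imp_right.2 fun hB => wu.and.2 ⟨hA, wu.neg.2 hB⟩)

end IsWorld

theorem J2_subset_of_J2p (h2 : Fml.J2p ⊆ {F | ILm X F}) : Fml.J2 ⊆ {F | ILm X F} := by
  rintro _ ⟨A, B, C, rfl⟩
  refine ILm.of_forall_world fun v w => w.imp.2 fun h => ?_
  obtain ⟨hAB, hBC⟩ := w.and.1 h
  exact w.rhd_trans_of_J2p h2 (w.rhd_mono_right (fun u wu hB => wu.or.2 (.inl hB)) hAB) hBC

theorem J4_subset_of_J2 (h2 : Fml.J2 ⊆ {F | ILm X F}) : Fml.J4 ⊆ {F | ILm X F} := by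
  rintro _ ⟨A, B, rfl⟩
  refine ILm.of_forall_world fun v w => w.imp.2 fun hAB => w.imp.2 fun hA => w.neg.2 fun hB => ?_
  exact w.neg.1 hA (w.rhd_bot_iff.1 (w.rhd_trans h2 hAB (w.rhd_bot_iff.2 hB)))

/-! ## The unary axioms in the binary logics -/

theorem toFml_uJ1 (h1 : Fml.J1 ⊆ {F | ILm X F}) : UFml.uJ1 ⊆ {A | ILm X A.toFml} := by
  rintro _ ⟨A, rfl⟩
  exact ILm.of_forall_world fun v w => w.imp.2 fun hA => w.rhd_of_J1 h1 fun u _ hu _ => hu _ hA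

theorem toFml_uJ15 (h1 : Fml.J1 ⊆ {F | ILm X F}) (h5 : Fml.J5 ⊆ {F | ILm X F}) :
    UFml.uJ15 ⊆ {A | ILm X A.toFml} := by
  rintro _ ⟨A, rfl⟩
  refine ILm.of_forall_world fun v w => w.imp.2 fun h => ?_
  exact w.rhd_mono_left_of_sees (fun u _ hu _ => hu _ h) (w.or_rhd (fun _ => .J3)
    (w.rhd_of_J1 h1 fun _ _ _ => id) (w.thm (h5 ⟨A.toFml, rfl⟩)))

theorem toFml_uJ25 (h2 : Fml.J2 ⊆ {F | ILm X F}) (h5 : Fml.J5 ⊆ {F | ILm X F}) :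
    UFml.uJ25 ⊆ {A | ILm X A.toFml} := by
  rintro _ ⟨A, B, rfl⟩
  refine ILm.of_forall_world fun v w => w.imp.2 fun hAB => w.imp.2 fun hA => ?_
  exact w.rhd_trans h2 hA (w.rhd_mono_left_of_sees (fun u wu hu => wu.imp.1 (hu _ hAB))
    (w.thm (h5 ⟨B.toFml, rfl⟩)))

theorem toFml_I2_of_J4p (h4 : Fml.J4p ⊆ {F | ILm X F}) : UFml.I2 ⊆ {A | ILm X A.toFml} := by
  rintro _ ⟨A, B, rfl⟩
  exact h4 ⟨_, _, _, rfl⟩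

theorem toFml_I2_of_J2p (h2 : Fml.J2p ⊆ {F | ILm X F}) : UFml.I2 ⊆ {A | ILm X A.toFml} := by
  rintro _ ⟨A, B, rfl⟩
  refine ILm.of_forall_world fun v w => w.imp.2 fun hAB => w.imp.2 fun hA => ?_
  -- `A` implies `(A ∧ ¬B) ∨ B`, and `(A ∧ ¬B) ▷ B` since `A ∧ ¬B` is false in accessible worlds.
  refine w.rhd_trans_of_J2p h2 (B := A.toFml.and B.toFml.neg) (w.rhd_mono_right ?_ hA) ?_
  · exact fun u wu hA => wu.or.2 (or_iff_not_imp_right.2 fun hB => wu.and.2 ⟨hA, wu.neg.2 hB⟩)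
  · exact w.rhd_of_forall_not fun u wu hu h =>
      wu.neg.1 (wu.and.1 h).2 (wu.imp.1 (hu _ hAB) (wu.and.1 h).1)

theorem toFml_I3 (h2 : Fml.J2p ⊆ {F | ILm X F}) (h5 : Fml.J5 ⊆ {F | ILm X F}) :
    UFml.I3 ⊆ {A | ILm X A.toFml} := by
  rintro _ ⟨A, rfl⟩
  refine ILm.of_forall_world fun v w => w.imp.2 fun h => ?_
  exact w.rhd_trans_of_J2p h2
    (w.rhd_mono_right (fun u wu hu => wu.or.2 (wu.or.1 hu).symm) h) (w.thm (h5 ⟨A.toFml, rfl⟩))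

theorem toFml_I4 (h4 : Fml.J4 ⊆ {F | ILm X F}) : UFml.I4 ⊆ {A | ILm X A.toFml} := by
  rintro _ ⟨A, rfl⟩
  refine ILm.of_forall_world fun v w => w.imp.2 fun h => ?_
  obtain ⟨hA, hTop⟩ := w.and.1 h
  exact w.imp.1 (w.imp.1 (w.thm (h4 ⟨_, _, rfl⟩)) hA) hTop

theorem ILm_toFml_of_ilm {Y : Set UFml} (hY : Y ⊆ {A | ILm X A.toFml}) {A : UFml}
    (h : ilm Y A) : ILm X A.toFml := by
  induction h with
  | ax h => exact hY h
  | G1 h => exact .G1 fun v hb hi => h (fun B => v B.toFml) hb fun _ _ => hi _ _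
  | G2 A B => exact .G2 _ _
  | G3 A => exact .G3 _
  | uJ6 => exact .J6 ⟨.bot, rfl⟩
  | mp _ _ ih₁ ih₂ => exact .mp ih₁ ih₂
  | nec _ ih => exact .nec ih
  | uR _ ih => exact .R1 _ ih

end Binary

/-! ## The two presentations of `CL` and `IL` -/

section Presentations

variable {X Z : Set Fml}

theorem J6_subset_of_J1_of_J4 (h1 : Fml.J1 ⊆ {F | GLProves X F})
    (h4 : Fml.J4 ⊆ {F | GLProves X F}) : Fml.J6 ⊆ {F | GLProves X F} := by
  rintro _ ⟨A, rfl⟩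
  refine GLProves.of_forall_world fun v w => w.iff.2 ⟨fun hA => ?_, fun h => ?_⟩
  · exact w.rhd_of_J1 h1 fun u wu hu hnA => absurd (hu _ hA) (wu.neg.1 hnA)
  · refine w.box_iff.2 fun u wu hu => by_contra fun hA => ?_
    obtain ⟨t, wt, -, ht⟩ := w.exists_of_rhd_of_J4 h4 h wu hu (wu.neg.2 hA)
    exact wt.bot ht

theorem J2p_subset_of_J1_of_J2_of_J3 (h1 : Fml.J1 ⊆ {F | GLProves X F})
    (h2 : Fml.J2 ⊆ {F | GLProves X F}) (h3 : Fml.J3 ⊆ {F | GLProves X F}) :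
    Fml.J2p ⊆ {F | GLProves X F} := by
  rintro _ ⟨A, B, C, rfl⟩
  refine GLProves.of_forall_world fun v w => w.imp.2 fun h => ?_
  obtain ⟨hABC, hBC⟩ := w.and.1 h
  exact w.rhd_trans h2 hABC (w.or_rhd h3 hBC (w.rhd_of_J1 h1 fun _ _ _ => id))

theorem GLProves.toILm (hX : X ⊆ {F | ILm Z F}) {A : Fml} (h : GLProves X A) : ILm Z A := by
  induction h with
  | ax h => exact hX h
  | G1 h => exact .G1 h
  | G2 A B => exact .G2 _ _
  | G3 A => exact .G3 _
  | mp _ _ ih₁ ih₂ => exact .mp ih₁ ih₂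
  | nec _ ih => exact .nec ih

theorem ILm.toGLProves (h1 : Fml.J1 ⊆ {F | GLProves X F}) (h2 : Fml.J2 ⊆ {F | GLProves X F})
    (h3 : Fml.J3 ⊆ {F | GLProves X F}) (h4 : Fml.J4 ⊆ {F | GLProves X F})
    (hZ : Z ⊆ {F | GLProves X F}) {A : Fml} (h : ILm Z A) : GLProves X A := by
  induction h with
  | ax h => exact hZ h
  | G1 h => exact .G1 h
  | G2 A B => exact .G2 _ _
  | G3 A => exact .G3 _
  | J3 h => exact h3 h
  | J6 h => exact J6_subset_of_J1_of_J4 h1 h4 h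
  | mp _ _ ih₁ ih₂ => exact .mp ih₁ ih₂
  | nec _ ih => exact .nec ih
  | R1 C _ ih =>
    exact .of_forall_world fun v w => w.imp.2 fun h =>
      w.rhd_trans h2 h (w.rhd_of_J1 h1 fun u wu _ => wu.imp.1 (wu.thm ih))
  | R2 C _ ih =>
    exact .of_forall_world fun v w => w.imp.2 fun h =>
      w.rhd_trans h2 (w.rhd_of_J1 h1 fun u wu _ => wu.imp.1 (wu.thm ih)) h

theorem GLProves_J1_J2_J3_J4_iff_ILm (A : Fml) :
    GLProves (Fml.J1 ∪ Fml.J2 ∪ Fml.J3 ∪ Fml.J4 ∪ Z) A ↔ ILm (Fml.J1 ∪ Fml.J2p ∪ Z) A := by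
  constructor
  · have h2 := J2_subset_of_J2p (X := Fml.J1 ∪ Fml.J2p ∪ Z) (ILm.subset (by grind))
    refine GLProves.toILm ?_
    simp only [Set.union_subset_iff]
    exact ⟨⟨⟨⟨ILm.subset (by grind), h2⟩, fun _ => .J3⟩, J4_subset_of_J2 h2⟩,
      ILm.subset (by grind)⟩
  · have hax : Fml.J1 ∪ Fml.J2 ∪ Fml.J3 ∪ Fml.J4 ∪ Z ⊆
        {F | GLProves (Fml.J1 ∪ Fml.J2 ∪ Fml.J3 ∪ Fml.J4 ∪ Z) F} := fun _ => .ax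
    simp only [Set.union_subset_iff] at hax
    obtain ⟨⟨⟨⟨h1, h2⟩, h3⟩, h4⟩, hZ⟩ := hax
    exact ILm.toGLProves h1 h2 h3 h4
      (Set.union_subset (Set.union_subset h1 (J2p_subset_of_J1_of_J2_of_J3 h1 h2 h3)) hZ)

theorem CL_iff_ILm (A : Fml) : CL A ↔ ILm (Fml.J1 ∪ Fml.J2p) A := by
  simpa only [CL, Set.union_empty] using GLProves_J1_J2_J3_J4_iff_ILm (Z := ∅) A

theorem IL_iff_ILm (A : Fml) : IL A ↔ ILm (Fml.J1 ∪ Fml.J2p ∪ Fml.J5) A :=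
  GLProves_J1_J2_J3_J4_iff_ILm A

end Presentations

/-! ## Unary fragments -/

section Fragments

/-- `ℓ` is the unary counterpart of `L`: it proves the same `L(□, I)`-formulas. -/
def IsUnaryFragment (L : Fml → Prop) (ℓ : UFml → Prop) : Prop :=
  ∀ A : UFml, L A.toFml ↔ ℓ A

variable {Z : Set Fml} {W Y : Set UFml}

theorem IsUnaryFragment.congr {L L' : Fml → Prop} {ℓ : UFml → Prop} (h : IsUnaryFragment L' ℓ)
    (hL : ∀ A, L A ↔ L' A) : IsUnaryFragment L ℓ :=
  fun A => (hL _).trans (h A)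

theorem isUnaryFragment_of_subset (hZ : Z ⊆ {A | ilm Y (A.toUnary false false)})
    (hY : Y ⊆ {A | ILm Z A.toFml}) : IsUnaryFragment (ILm Z) (ilm Y) :=
  fun _ => ⟨ilm_of_ILm_toFml ilm_box_reach_false_imp_I hZ, ILm_toFml_of_ilm hY⟩

theorem isUnaryFragment_union_J5 (hZ : Z ⊆ {A | ilm Y (A.toUnary false true)})
    (hY : Y ⊆ {A | ILm (Z ∪ Fml.J5) A.toFml}) : IsUnaryFragment (ILm (Z ∪ Fml.J5)) (ilm Y) :=
  fun _ => ⟨ilm_of_ILm_toFml ilm_box_reach_false_imp_I (Set.union_subset hZ toUnary_J5),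
    ILm_toFml_of_ilm hY⟩

theorem isUnaryFragment_J1_union (hZ : Z ⊆ {A | ilm (UFml.uJ1 ∪ W) (A.toUnary true false)})
    (hW : W ⊆ {A | ILm (Fml.J1 ∪ Z) A.toFml}) :
    IsUnaryFragment (ILm (Fml.J1 ∪ Z)) (ilm (UFml.uJ1 ∪ W)) :=
  fun _ => ⟨ilm_of_ILm_toFml (fun A => .ax (.inl ⟨A, rfl⟩)) (Set.union_subset toUnary_J1 hZ),
    ILm_toFml_of_ilm (Set.union_subset (toFml_uJ1 (ILm.subset (by grind))) hW)⟩

theorem isUnaryFragment_J1_union_J5 (h15 : UFml.uJ15 ⊆ {F | ilm Y F})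
    (hZ : Z ⊆ {A | ilm Y (A.toUnary true true)})
    (hY : Y ⊆ {A | ILm (Fml.J1 ∪ Z ∪ Fml.J5) A.toFml}) :
    IsUnaryFragment (ILm (Fml.J1 ∪ Z ∪ Fml.J5)) (ilm Y) :=
  fun _ => ⟨ilm_of_ILm_toFml (fun A => h15 ⟨A, rfl⟩)
    (Set.union_subset (Set.union_subset toUnary_J1 hZ) toUnary_J5), ILm_toFml_of_ilm hY⟩

section Rows

open Fml UFml

theorem isUnaryFragment_ILm : IsUnaryFragment (ILm ∅) (ilm ∅) :=
  isUnaryFragment_of_subset (Set.empty_subset _) (Set.empty_subset _)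

theorem isUnaryFragment_ILm_J5 : IsUnaryFragment (ILm J5) (ilm ∅) := by
  simpa only [Set.empty_union] using
    isUnaryFragment_union_J5 (Set.empty_subset _) (Set.empty_subset _)

theorem isUnaryFragment_ILm_J1 : IsUnaryFragment (ILm J1) (ilm uJ1) := by
  simpa only [Set.union_empty] using
    isUnaryFragment_J1_union (Set.empty_subset _) (Set.empty_subset _)

theorem isUnaryFragment_ILm_J1_J5 : IsUnaryFragment (ILm (J1 ∪ J5)) (ilm uJ15) := by
  simpa only [Set.union_empty] using isUnaryFragment_J1_union_J5 (ilm.subset subset_rfl)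
    (Set.empty_subset _) (toFml_uJ15 (ILm.subset (by grind)) (ILm.subset (by grind)))

theorem isUnaryFragment_ILm_J4p : IsUnaryFragment (ILm J4p) (ilm I2) :=
  isUnaryFragment_of_subset (toUnary_J4p (ilm.subset subset_rfl))
    (toFml_I2_of_J4p (ILm.subset subset_rfl))

theorem isUnaryFragment_ILm_J4p_J5 : IsUnaryFragment (ILm (J4p ∪ J5)) (ilm I2) :=
  isUnaryFragment_union_J5 (toUnary_J4p (ilm.subset subset_rfl))
    (toFml_I2_of_J4p (ILm.subset (by grind)))

theorem isUnaryFragment_ILm_J1_J4p : IsUnaryFragment (ILm (J1 ∪ J4p)) (ilm (uJ1 ∪ I2)) :=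
  isUnaryFragment_J1_union (toUnary_J4p (ilm.subset (by grind)))
    (toFml_I2_of_J4p (ILm.subset (by grind)))

theorem isUnaryFragment_ILm_J1_J4p_J5 :
    IsUnaryFragment (ILm (J1 ∪ J4p ∪ J5)) (ilm (uJ15 ∪ I2)) :=
  isUnaryFragment_J1_union_J5 (ilm.subset (by grind)) (toUnary_J4p (ilm.subset (by grind)))
    (Set.union_subset (toFml_uJ15 (ILm.subset (by grind)) (ILm.subset (by grind)))
      (toFml_I2_of_J4p (ILm.subset (by grind))))

theorem isUnaryFragment_ILm_J2p : IsUnaryFragment (ILm J2p) (ilm I2) :=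
  isUnaryFragment_of_subset (toUnary_J2p (ilm.subset subset_rfl) nofun)
    (toFml_I2_of_J2p (ILm.subset subset_rfl))

theorem isUnaryFragment_ILm_J2p_J5 : IsUnaryFragment (ILm (J2p ∪ J5)) (ilm (I2 ∪ I3)) :=
  isUnaryFragment_union_J5 (toUnary_J2p (ilm.subset (by grind)) fun _ => ilm.subset (by grind))
    (Set.union_subset (toFml_I2_of_J2p (ILm.subset (by grind)))
      (toFml_I3 (ILm.subset (by grind)) (ILm.subset (by grind))))

theorem isUnaryFragment_ILm_J1_J2p : IsUnaryFragment (ILm (J1 ∪ J2p)) (ilm (uJ1 ∪ I2)) :=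
  isUnaryFragment_J1_union (toUnary_J2p (ilm.subset (by grind)) nofun)
    (toFml_I2_of_J2p (ILm.subset (by grind)))

theorem isUnaryFragment_ILm_J1_J2p_J5 :
    IsUnaryFragment (ILm (J1 ∪ J2p ∪ J5)) (ilm (uJ1 ∪ I2 ∪ I3)) :=
  isUnaryFragment_J1_union_J5
    (uJ15_subset_of_uJ1_of_I3 (ilm.subset (by grind)) (ilm.subset (by grind)))
    (toUnary_J2p (ilm.subset (by grind)) fun _ => ilm.subset (by grind))
    (Set.union_subset (Set.union_subset (toFml_uJ1 (ILm.subset (by grind)))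
      (toFml_I2_of_J2p (ILm.subset (by grind))))
      (toFml_I3 (ILm.subset (by grind)) (ILm.subset (by grind))))

theorem isUnaryFragment_CL : IsUnaryFragment CL (ilm (uJ1 ∪ I2)) :=
  isUnaryFragment_ILm_J1_J2p.congr CL_iff_ILm

theorem isUnaryFragment_IL : IsUnaryFragment IL (ilm (uJ1 ∪ I2 ∪ I3)) :=
  isUnaryFragment_ILm_J1_J2p_J5.congr IL_iff_ILm

theorem isUnaryFragment_ILm_J4 : IsUnaryFragment (ILm J4) (ilm I4) :=
  isUnaryFragment_of_subset (toUnary_J4 (ilm.subset subset_rfl))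
    (toFml_I4 (ILm.subset subset_rfl))

theorem isUnaryFragment_ILm_J4_J5 : IsUnaryFragment (ILm (J4 ∪ J5)) (ilm I4) :=
  isUnaryFragment_union_J5 (toUnary_J4 (ilm.subset subset_rfl))
    (toFml_I4 (ILm.subset (by grind)))

theorem isUnaryFragment_ILm_J1_J4 : IsUnaryFragment (ILm (J1 ∪ J4)) (ilm (uJ1 ∪ I4)) :=
  isUnaryFragment_J1_union (toUnary_J4 (ilm.subset (by grind)))
    (toFml_I4 (ILm.subset (by grind)))

theorem isUnaryFragment_ILm_J1_J4_J5 :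
    IsUnaryFragment (ILm (J1 ∪ J4 ∪ J5)) (ilm (uJ15 ∪ I4)) :=
  isUnaryFragment_J1_union_J5 (ilm.subset (by grind)) (toUnary_J4 (ilm.subset (by grind)))
    (Set.union_subset (toFml_uJ15 (ILm.subset (by grind)) (ILm.subset (by grind)))
      (toFml_I4 (ILm.subset (by grind))))

theorem isUnaryFragment_ILm_J2 : IsUnaryFragment (ILm J2) (ilm I4) :=
  isUnaryFragment_of_subset (toUnary_J2_of_I4 (ilm.subset subset_rfl))
    (toFml_I4 (J4_subset_of_J2 (ILm.subset subset_rfl)))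

theorem isUnaryFragment_ILm_J2_J5 : IsUnaryFragment (ILm (J2 ∪ J5)) (ilm (uJ25 ∪ I4)) :=
  isUnaryFragment_union_J5 (toUnary_J2_of_uJ25 (ilm.subset (by grind)))
    (Set.union_subset (toFml_uJ25 (ILm.subset (by grind)) (ILm.subset (by grind)))
      (toFml_I4 (J4_subset_of_J2 (ILm.subset (by grind)))))

theorem isUnaryFragment_ILm_J2_J4p : IsUnaryFragment (ILm (J2 ∪ J4p)) (ilm I2) :=
  have h2 : I2 ⊆ {F | ilm I2 F} := ilm.subset subset_rfl
  isUnaryFragment_of_subset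
    (Set.union_subset (toUnary_J2_of_I4 (I4_subset_of_I2 h2)) (toUnary_J4p h2))
    (toFml_I2_of_J4p (ILm.subset (by grind)))

theorem isUnaryFragment_ILm_J2_J4p_J5 :
    IsUnaryFragment (ILm (J2 ∪ J4p ∪ J5)) (ilm (I2 ∪ uJ25)) :=
  isUnaryFragment_union_J5
    (Set.union_subset (toUnary_J2_of_uJ25 (ilm.subset (by grind)))
      (toUnary_J4p (ilm.subset (by grind))))
    (Set.union_subset (toFml_I2_of_J4p (ILm.subset (by grind)))
      (toFml_uJ25 (ILm.subset (by grind)) (ILm.subset (by grind))))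

end Rows

end Fragments

end UnaryIL

open UnaryIL in
theorem mainTheorem1 :
    ∀ row ∈ UnaryIL.table, ∀ A : UnaryIL.UFml, row.1 A.toFml ↔ row.2 A := by
  simp only [table, List.forall_mem_cons, List.not_mem_nil, false_imp_iff, implies_true, and_true]
  exact ⟨isUnaryFragment_ILm, isUnaryFragment_ILm_J5, isUnaryFragment_ILm_J1,
    isUnaryFragment_ILm_J4p, isUnaryFragment_ILm_J4p_J5, isUnaryFragment_ILm_J2p,
    isUnaryFragment_ILm_J1_J5, isUnaryFragment_ILm_J1_J4p, isUnaryFragment_CL,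
    isUnaryFragment_ILm_J1_J2p, isUnaryFragment_ILm_J1_J4p_J5, isUnaryFragment_ILm_J2p_J5,
    isUnaryFragment_IL, isUnaryFragment_ILm_J1_J2p_J5, isUnaryFragment_ILm_J4,
    isUnaryFragment_ILm_J4_J5, isUnaryFragment_ILm_J2, isUnaryFragment_ILm_J1_J4,
    isUnaryFragment_ILm_J1_J4_J5, isUnaryFragment_ILm_J2_J5, isUnaryFragment_ILm_J2_J4p,
    isUnaryFragment_ILm_J2_J4p_J5⟩
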